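/- Let $\mathbb F_q$ be a finite field, let $\ell, m$ be integers with $2<\ell<m$, and let $V$ be an $m$-dimensional vector space over $\mathbb F_q$ with a fixed basis, by which $\bigwedge^m V$ is identified with $\mathbb F_q$. Let $A_1\subset\dots\subset A_\ell$ be a strictly increasing sequence of nonzero subspaces of $V$, and put $\alpha=(\alpha_1,\dots,\alpha_\ell)$ with $\alpha_i=\dim A_i$. Let $$\Omega_\alpha(\ell,m)=\{L\subseteq V \text{ a subspace}:\ \dim L=\ell \text{ and } \dim(L\cap A_i)\ge i \text{ for } i=1,\dots,\ell\},$$ let $L_1,\dots,L_n$ be an enumeration without repetition of its elements, and for each $j$ let $P_j\in\bigwedge^\ell V$ be a representative of $L_j$, that is, a nonzero element of the form $v_\ell\wedge\dots\wedge v_1$ with $v_i\in A_i$ for $i=1,\dots,\ell$ and $\{x\in V: P_j\wedge x=0\}=L_j$. The Schubert code $C_\alpha(\ell,m)\subseteq\mathbb F_q^n$ is the image of the linear map $$\bigwedge^{m-\ell}V\to\mathbb F_q^n,\qquad f\mapsto c_f=(f\wedge P_1,\dots,f\wedge P_n).$$ Its minimum distance $d$ is the least Hamming weight of a nonzero codeword,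 and its minimum weight codewords are the codewords of Hamming weight $d$. Suppose that $\alpha$ is completely non-consecutive, i.e. $\alpha_{i+1}-\alpha_i\ge 2$ for $i=1,\dots,\ell-1$. Then $C_\alpha(\ell,m)$ is not generated by its minimum weight codewords, i.e. the $\mathbb F_q$-linear span of the minimum weight codewords of $C_\alpha(\ell,m)$ is not all of $C_\alpha(\ell,m)$. -/

import Mathlib

open scoped ExteriorAlgebra

namespace SchubertCodes

noncomputable section

/-! ### Linear codes -/

/-- The minimum distance `d(C)`: the least Hamming weight of a nonzero codeword. -/
def minDistance {F : Type*} [Field F] [DecidableEq F] {n : ℕ}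
    (C : Submodule F (Fin n → F)) : ℕ :=
  sInf {w : ℕ | ∃ c ∈ C, c ≠ 0 ∧ hammingNorm c = w}

/-- The minimum weight codewords of `C`: the codewords of Hamming weight `d(C)`. -/
def minWeightCodewords {F : Type*} [Field F] [DecidableEq F] {n : ℕ}
    (C : Submodule F (Fin n → F)) : Set (Fin n → F) :=
  {c | c ∈ C ∧ hammingNorm c = minDistance C}

/-- `C` is generated by its minimum weight codewords, i.e. is their linear span. -/
def IsGeneratedByMinWeight {F : Type*} [Field F] [DecidableEq F] {n : ℕ}
    (C : Submodule F (Fin n → F)) : Prop :=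
  Submodule.span F (minWeightCodewords C) = C

/-! ### Exterior powers -/

/-- The exterior product `f ∧ g` of `f ∈ ⋀^d V` and `g ∈ ⋀^e V`, as an element of `⋀^m V`, where
`m = d + e`. -/
def wedge {F V : Type*} [Field F] [AddCommGroup V] [Module F V] {d e m : ℕ} (h : d + e = m)
    (f : ⋀[F]^d V) (g : ⋀[F]^e V) : ⋀[F]^m V :=
  ⟨(f : ExteriorAlgebra F V) * (g : ExteriorAlgebra F V),
    h ▸ SetLike.mul_mem_graded f.2 g.2⟩

/-- The identification of `⋀^m V` with `F` given by a basis `e_1, …, e_m` of `V`: the linear map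
that sends `v_1 ∧ ⋯ ∧ v_m` to the determinant of `v_1, …, v_m` with respect to the basis; in
particular it sends `e_1 ∧ ⋯ ∧ e_m` to `1`. -/
def topPowerToField {F V : Type*} [Field F] [AddCommGroup V] [Module F V] {m : ℕ}
    (b : Module.Basis (Fin m) F V) : ⋀[F]^m V →ₗ[F] F :=
  exteriorPower.alternatingMapLinearEquiv b.det

/-- The annihilator `V_f = {x ∈ V : f ∧ x = 0}` of `f ∈ ⋀^d V`. -/
def annihilator {F V : Type*} [Field F] [AddCommGroup V] [Module F V] {d : ℕ}
    (f : ⋀[F]^d V) : Submodule F V :=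
  LinearMap.ker
    (LinearMap.mulLeft F (f : ExteriorAlgebra F V) ∘ₗ ExteriorAlgebra.ι F)

/-! ### Schubert varieties and Schubert codes

A partial flag `A_1 ⊂ ⋯ ⊂ A_ℓ` is a strictly monotone family `A : Fin ℓ → Submodule F V`; the
subspace `A_i` is `A` at the index `i - 1`. -/

/-- The dimension sequence `α = (dim A_1, …, dim A_ℓ)`. -/
def dimSeq {F V : Type*} [Field F] [AddCommGroup V] [Module F V] {ℓ : ℕ}
    (A : Fin ℓ → Submodule F V) : Fin ℓ → ℕ :=
  fun i => Module.finrank F (A i)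

/-- `α` is completely non-consecutive: `α_{i+1} - α_i ≥ 2` for `1 ≤ i ≤ ℓ - 1`. -/
def CompletelyNonConsecutive {ℓ : ℕ} (α : Fin ℓ → ℕ) : Prop :=
  ∀ i j : Fin ℓ, (j : ℕ) = i + 1 → α i + 2 ≤ α j

/-- The Schubert variety `Ω_α(ℓ, m)`: the `ℓ`-dimensional subspaces `L` of `V` such that
`dim (L ∩ A_i) ≥ i` for `i = 1, …, ℓ`. -/
def schubertVariety {F V : Type*} [Field F] [AddCommGroup V] [Module F V] {ℓ : ℕ}
    (A : Fin ℓ → Submodule F V) : Set (Submodule F V) :=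
  {L | Module.finrank F L = ℓ ∧
    ∀ i : Fin ℓ, (i : ℕ) + 1 ≤ Module.finrank F (L ⊓ A i : Submodule F V)}

/-- `P ∈ ⋀^ℓ V` is an admissible representative of `L`: it is nonzero, of the form
`v_ℓ ∧ ⋯ ∧ v_1` with `v_i ∈ A_i` for all `i`, and `V_P = L`. -/
def IsRepresentative {F V : Type*} [Field F] [AddCommGroup V] [Module F V] {ℓ : ℕ}
    (A : Fin ℓ → Submodule F V) (L : Submodule F V) (P : ⋀[F]^ℓ V) : Prop :=
  P ≠ 0 ∧
  (∃ v : Fin ℓ → V, (∀ i, v i ∈ A i) ∧ P = exteriorPower.ιMulti F ℓ (fun i => v i.rev)) ∧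
  annihilator P = L

/-- The evaluation map `f ↦ c_f = (f ∧ P_1, …, f ∧ P_n)` from `⋀^(m-ℓ) V` to `F^n`, where `⋀^m V`
is identified with `F` through the basis `b`. -/
def evalMap {F V : Type*} [Field F] [AddCommGroup V] [Module F V] {ℓ m n : ℕ} (h : ℓ ≤ m)
    (b : Module.Basis (Fin m) F V) (P : Fin n → ⋀[F]^ℓ V) :
    ⋀[F]^(m - ℓ) V →ₗ[F] (Fin n → F) where
  toFun f := fun j => topPowerToField b (wedge (Nat.sub_add_cancel h) f (P j))
  map_add' f g := by
    funext j
    rw [Pi.add_apply, ← map_add]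
    congr 1
    exact Subtype.ext (add_mul _ _ _)
  map_smul' a f := by
    funext j
    rw [Pi.smul_apply, ← map_smul]
    congr 1
    exact Subtype.ext (smul_mul_assoc _ _ _)

/-- The Schubert code `C_α(ℓ, m)`, built with the basis `b` and the representatives
`P_1, …, P_n`: the image of the evaluation map. -/
def schubertCode {F V : Type*} [Field F] [AddCommGroup V] [Module F V] {ℓ m n : ℕ} (h : ℓ ≤ m)
    (b : Module.Basis (Fin m) F V) (P : Fin n → ⋀[F]^ℓ V) : Submodule F (Fin n → F) :=
  LinearMap.range (evalMap h b P)

end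

end SchubertCodes

/-! The wedge pairing is perfect, so codewords come from alternating `ℓ`-forms `φ` on `V`, and the
weight of `φ` is the number of points `L` of the Schubert variety with `φ` nonzero on `L`. Put `T =
A_ℓ`, `B = A_{ℓ-1}`. A form that is nonzero at some point inside `B` never has minimum weight
(`exists_smaller_formSupport`). Such points exist, because the gaps and `ℓ > 2` force `dim B ≥ ℓ`.
All minimum weight codewords thus vanish at a coordinate where some codeword does not, and they
cannot span.

The comparison is a double count. Let `q = |F|`, `t = dim T`, `s = dim B`, and let `d` be the least
nonzero weight on the Schubert variety of the flag without `T`. If `g` is a linear form that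
vanishes on `B` but not on `T`, and `ψ` has weight `d`, then `g ∧ ψ` has weight `N₀` with `N₀
q^(ℓ-1) ≤ d q^(t-1)`. For `φ` of weight `N`, let `E` count the points `L'` of the smaller variety at
which some `φ(v, ·)`, `v ∈ T`, is nonzero. Extending `L'` by vectors of `T` outside `B` gives `N
q^(ℓ-1) ≥ E (q^(t-1) - q^(s-1))`. If `φ` is nonzero at a point inside `B`, the forms `φ(v, ·)` make
up a family of dimension at least two on the smaller variety, whence `q E ≥ (q + 1) d`. Together
these give `N₀ < N` as soon as `q^(t-s) > q + 1`, which holds because `t - s ≥ 2`. -/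

namespace SchubertCodes

/-! ### The wedge pairing -/

section WedgePairing

variable {F V : Type*} [Field F] [AddCommGroup V] [Module F V]

/-- The pairing `(f, g) ↦ f ∧ g` between `⋀^d V` and `⋀^e V`, where `⋀^m V` is identified with
`F` through the basis `b`. -/
noncomputable def wedgePairing {d e m : ℕ} (h : d + e = m) (b : Module.Basis (Fin m) F V) :
    ⋀[F]^d V →ₗ[F] ⋀[F]^e V →ₗ[F] F :=
  LinearMap.mk₂ F (fun f g => topPowerToField b (wedge h f g))
    (fun f f' g => by
      rw [← map_add]; congr 1; exact Subtype.ext (add_mul _ _ _))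
    (fun a f g => by
      rw [← map_smul]; congr 1; exact Subtype.ext (smul_mul_assoc _ _ _))
    (fun f g g' => by
      rw [← map_add]; congr 1; exact Subtype.ext (mul_add _ _ _))
    (fun a f g => by
      rw [← map_smul]; congr 1; exact Subtype.ext (mul_smul_comm _ _ _))

lemma wedgePairing_apply {d e m : ℕ} (h : d + e = m) (b : Module.Basis (Fin m) F V)
    (f : ⋀[F]^d V) (g : ⋀[F]^e V) :
    wedgePairing h b f g = topPowerToField b (wedge h f g) := rfl

lemma wedgePairing_ιMulti_ιMulti {d e : ℕ} (b : Module.Basis (Fin (d + e)) F V)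
    (v : Fin d → V) (w : Fin e → V) :
    wedgePairing rfl b (exteriorPower.ιMulti F d v) (exteriorPower.ιMulti F e w) =
      b.det (Fin.append v w) := by
  have : wedge (rfl : d + e = d + e) (exteriorPower.ιMulti F d v) (exteriorPower.ιMulti F e w) =
      exteriorPower.ιMulti F (d + e) (Fin.append v w) :=
    Subtype.ext (ExteriorAlgebra.ιMulti_mul_ιMulti v w)
  rw [wedgePairing_apply, this]
  exact exteriorPower.alternatingMapLinearEquiv_apply_ιMulti _ _

lemma det_comp_ne_zero_iff {n : ℕ} (b : Module.Basis (Fin n) F V) (σ : Fin n → Fin n) :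
    b.det (b ∘ σ) ≠ 0 ↔ Function.Injective σ := by
  constructor
  · intro h
    by_contra hσ
    exact h (b.det.map_eq_zero_of_not_injective _ fun hi => hσ (Function.Injective.of_comp hi))
  · intro h
    let e : Equiv.Perm (Fin n) := Equiv.ofBijective σ (Finite.injective_iff_bijective.mp h)
    have : b.det (b ∘ σ) = Equiv.Perm.sign e • b.det b := b.det.map_perm b e
    rw [this, b.det_self]
    rcases Int.units_eq_one_or (Equiv.Perm.sign e) with h1 | h1 <;> simp [h1]

/-- The witness is the basis monomial indexed by the complement of `T`: its product with the
monomial of `S` has a repeated factor unless `S = T`. Up to scalars this is the dual basis. -/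
lemma exists_wedgePairing_basis {d e m : ℕ} (h : d + e = m) (b : Module.Basis (Fin m) F V)
    (T : Set.powersetCard (Fin m) e) :
    ∃ f : ⋀[F]^d V, ∀ S : Set.powersetCard (Fin m) e,
      wedgePairing h b f (b.exteriorPower e S) ≠ 0 ↔ S = T := by
  subst h
  let T' : Set.powersetCard (Fin (d + e)) d :=
    ⟨(T.1)ᶜ, by
      have := T.2
      simp only [Set.powersetCard.mem_iff] at this ⊢
      rw [Finset.card_compl, this, Fintype.card_fin]; omega⟩
  refine ⟨exteriorPower.ιMulti_family F d b T', fun S => ?_⟩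
  rw [exteriorPower.basis_apply]
  set s := Set.powersetCard.ofFinEmbEquiv.symm S with hs
  set t := Set.powersetCard.ofFinEmbEquiv.symm T' with ht
  have happ : Fin.append (b ∘ t) (b ∘ s) = b ∘ Fin.append t s := by
    funext i
    refine Fin.addCases (fun i => ?_) (fun i => ?_) i <;> simp
  have key : wedgePairing rfl b (exteriorPower.ιMulti_family F d b T')
      (exteriorPower.ιMulti_family F e b S) = b.det (b ∘ Fin.append t s) := by
    rw [← happ]; exact wedgePairing_ιMulti_ιMulti b _ _
  rw [key, det_comp_ne_zero_iff, Fin.append_injective_iff]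
  have hms : ∀ i, i ∈ S.1 ↔ ∃ j, s j = i := fun i =>
    (Set.powersetCard.mem_range_ofFinEmbEquiv_symm_iff_mem S i).symm
  have hmt : ∀ i, i ∈ (T.1)ᶜ ↔ ∃ j, t j = i := fun i =>
    (Set.powersetCard.mem_range_ofFinEmbEquiv_symm_iff_mem T' i).symm
  have hcS : S.1.card = e := S.2
  have hcT : T.1.card = e := T.2
  constructor
  · rintro ⟨-, -, hd⟩
    apply Subtype.ext
    apply Finset.eq_of_subset_of_card_le _ (by rw [hcS, hcT])
    intro i hi
    by_contra hiT
    obtain ⟨j, rfl⟩ := (hms i).1 hi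
    obtain ⟨j', hj'⟩ := (hmt _).1 (Finset.mem_compl.2 hiT)
    exact hd _ _ hj'
  · rintro rfl
    refine ⟨t.injective, s.injective, fun i j hij => ?_⟩
    have h1 := (hmt (t i)).2 ⟨i, rfl⟩
    have h2 := (hms (s j)).2 ⟨j, rfl⟩
    rw [← hij] at h2
    exact Finset.mem_compl.1 h1 h2

/-- Every linear form on `⋀^e V` is the wedge product with some element of `⋀^d V`. -/
lemma wedgePairing_surjective {d e m : ℕ} (h : d + e = m) (b : Module.Basis (Fin m) F V) :
    Function.Surjective (wedgePairing h b : ⋀[F]^d V →ₗ[F] ⋀[F]^e V →ₗ[F] F) := by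
  intro Φ
  choose f hf using exists_wedgePairing_basis (d := d) h b (e := e)
  classical
  refine ⟨∑ T, (Φ (b.exteriorPower e T) *
    (wedgePairing h b (f T) (b.exteriorPower e T))⁻¹) • f T, ?_⟩
  refine (b.exteriorPower e).ext fun S => ?_
  rw [map_sum, LinearMap.sum_apply, Finset.sum_eq_single S]
  · rw [map_smul, LinearMap.smul_apply, smul_eq_mul, mul_assoc,
      inv_mul_cancel₀ ((hf S S).2 rfl), mul_one]
  · intro T _ hTS
    have : wedgePairing h b (f T) (b.exteriorPower e S) = 0 := by
      by_contra hne
      exact hTS ((hf T S).1 hne).symm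
    rw [map_smul, LinearMap.smul_apply, this, smul_zero]
  · intro hS
    exact absurd (Finset.mem_univ S) hS

/-- The alternating form `w ↦ f ∧ w_1 ∧ ⋯ ∧ w_e`. -/
noncomputable def wedgeForm {d e m : ℕ} (h : d + e = m) (b : Module.Basis (Fin m) F V)
    (f : ⋀[F]^d V) : V [⋀^Fin e]→ₗ[F] F :=
  exteriorPower.alternatingMapLinearEquiv.symm (wedgePairing h b f)

lemma wedgeForm_apply {d e m : ℕ} (h : d + e = m) (b : Module.Basis (Fin m) F V)
    (f : ⋀[F]^d V) (w : Fin e → V) :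
    wedgeForm h b f w = topPowerToField b (wedge h f (exteriorPower.ιMulti F e w)) :=
  exteriorPower.alternatingMapLinearEquiv_symm_apply _ _

lemma wedgeForm_surjective {d e m : ℕ} (h : d + e = m) (b : Module.Basis (Fin m) F V) :
    Function.Surjective (wedgeForm (d := d) (e := e) h b) :=
  exteriorPower.alternatingMapLinearEquiv.symm.surjective.comp (wedgePairing_surjective h b)

lemma mem_annihilator_ιMulti {e : ℕ} (w : Fin e → V) (i : Fin e) :
    w i ∈ annihilator (exteriorPower.ιMulti F e w) := by
  change ExteriorAlgebra.ιMulti F e w * ExteriorAlgebra.ι F (w i) = 0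
  have h1 : ExteriorAlgebra.ι F (w i) = ExteriorAlgebra.ιMulti F 1 (fun _ => w i) := by
    simp [ExteriorAlgebra.ιMulti_apply]
  rw [h1, ExteriorAlgebra.ιMulti_mul_ιMulti]
  refine AlternatingMap.map_eq_zero_of_eq _ _ (i := Fin.castAdd 1 i) (j := Fin.natAdd e 0) ?_ ?_
  · simp
  · intro h
    have := congrArg Fin.val h
    simp at this
    omega

end WedgePairing

/-! ### Alternating forms restricted to subspaces -/

section Forms

variable {F V : Type*} [Field F] [AddCommGroup V] [Module F V]

/-- The alternating form `φ` does not vanish identically on the subspace `L`. -/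
def NonzeroOn {k : ℕ} (φ : V [⋀^Fin k]→ₗ[F] F) (L : Submodule F V) : Prop :=
  ∃ w : Fin k → V, (∀ i, w i ∈ L) ∧ φ w ≠ 0

lemma linearIndependent_of_map_ne_zero {k : ℕ} {φ : V [⋀^Fin k]→ₗ[F] F} {w : Fin k → V}
    (h : φ w ≠ 0) : LinearIndependent F w := by
  by_contra hw
  exact h (φ.map_linearDependent w hw)

lemma span_eq_of_finrank_eq [FiniteDimensional F V] {k : ℕ} {L : Submodule F V}
    (hL : Module.finrank F L = k) {w : Fin k → V} (hw : LinearIndependent F w)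
    (hwL : ∀ i, w i ∈ L) : Submodule.span F (Set.range w) = L := by
  refine Submodule.eq_of_le_of_finrank_eq (Submodule.span_le.2 ?_) ?_
  · rintro _ ⟨i, rfl⟩; exact hwL i
  · rw [finrank_span_eq_card hw, Fintype.card_fin, hL]

/-- Top-degree forms on a `k`-dimensional space are determined by their value on one basis, so
nonvanishing on `L` can be tested on any basis of `L`. -/
lemma nonzeroOn_iff [FiniteDimensional F V] {k : ℕ} {L : Submodule F V}
    (hL : Module.finrank F L = k) {w : Fin k → V} (hw : LinearIndependent F w)
    (hwL : ∀ i, w i ∈ L) (φ : V [⋀^Fin k]→ₗ[F] F) : NonzeroOn φ L ↔ φ w ≠ 0 := by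
  refine ⟨?_, fun h => ⟨w, hwL, h⟩⟩
  rintro ⟨u, huL, hu⟩
  let w' : Fin k → L := fun i => ⟨w i, hwL i⟩
  have hw' : LinearIndependent F w' := by
    apply LinearIndependent.of_comp L.subtype
    exact hw
  rcases Nat.eq_zero_or_pos k with rfl | hk
  · rwa [Subsingleton.elim w u]
  have : Nonempty (Fin k) := ⟨⟨0, hk⟩⟩
  let e := basisOfLinearIndependentOfCardEqFinrank hw' (by rw [Fintype.card_fin, hL])
  have he : (φ.compLinearMap L.subtype) e = φ w := by
    rw [AlternatingMap.compLinearMap_apply]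
    congr 1
    funext i
    simp [e, w']
  rw [← he, AlternatingMap.map_basis_ne_zero_iff]
  intro h0
  apply hu
  have := congrArg (fun g => g fun i => (⟨u i, huL i⟩ : L)) h0
  simpa using this

/-- Greedy choice: the vectors already chosen span too small a space to contain the next `U i`.
Applied to `L ⊓ A i`, this gives bases of `L` adapted to the flag. -/
lemma exists_linearIndependent_mem [FiniteDimensional F V] :
    ∀ {k : ℕ} (U : Fin k → Submodule F V), (∀ i : Fin k, (i : ℕ) + 1 ≤ Module.finrank F (U i)) →
      ∃ w : Fin k → V, LinearIndependent F w ∧ ∀ i, w i ∈ U i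
  | 0, _, _ => ⟨Fin.elim0, linearIndependent_empty_type, fun i => i.elim0⟩
  | k + 1, U, hU => by
    obtain ⟨w, hw, hwU⟩ := exists_linearIndependent_mem (fun i : Fin k => U i.castSucc)
      (fun i => by simpa using hU i.castSucc)
    have hnot : ¬ U (Fin.last k) ≤ Submodule.span F (Set.range w) := by
      intro hle
      have h1 := Submodule.finrank_mono hle
      rw [finrank_span_eq_card hw, Fintype.card_fin] at h1
      have h2 := hU (Fin.last k)
      simp at h2
      omega
    obtain ⟨x, hx, hxw⟩ := SetLike.not_le_iff_exists.1 hnot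
    refine ⟨Fin.snoc w x, linearIndependent_finSnoc.2 ⟨hw, hxw⟩, fun i => ?_⟩
    refine Fin.lastCases ?_ (fun i => ?_) i
    · simpa using hx
    · simpa using hwU i

lemma exists_map_ne_zero {k : ℕ} {w : Fin k → V} (hw : LinearIndependent F w) :
    ∃ φ : V [⋀^Fin k]→ₗ[F] F, φ w ≠ 0 := by
  obtain ⟨g, hg⟩ := (Fintype.linearCombination F w).exists_leftInverse_of_injective
    (LinearMap.ker_eq_bot.2 (linearIndependent_iff_injective_fintypeLinearCombination.1 hw))
  refine ⟨(Pi.basisFun F (Fin k)).det.compLinearMap g, ?_⟩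
  have : (fun i => g (w i)) = Pi.basisFun F (Fin k) := by
    funext i
    have := congrArg (fun f => f (Pi.basisFun F (Fin k) i)) hg
    simpa using this
  rw [AlternatingMap.compLinearMap_apply]
  change (Pi.basisFun F (Fin k)).det (fun i => g (w i)) ≠ 0
  rw [this, Module.Basis.det_self]
  exact one_ne_zero

lemma span_mem_schubertVariety [FiniteDimensional F V] {k : ℕ} {A : Fin k → Submodule F V}
    (hA : Monotone A) {w : Fin k → V} (hw : LinearIndependent F w) (hwA : ∀ i, w i ∈ A i) :
    Submodule.span F (Set.range w) ∈ schubertVariety A := by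
  refine ⟨by rw [finrank_span_eq_card hw, Fintype.card_fin], fun i => ?_⟩
  let c : Fin (i + 1) → Fin k := Fin.castLE i.2
  have hc : LinearIndependent F (w ∘ c) := hw.comp c (Fin.castLE_injective _)
  have h1 : Submodule.span F (Set.range (w ∘ c)) ≤ Submodule.span F (Set.range w) ⊓ A i := by
    refine Submodule.span_le.2 ?_
    rintro _ ⟨j, rfl⟩
    refine ⟨Submodule.subset_span ⟨_, rfl⟩, hA ?_ (hwA (c j))⟩
    exact Fin.le_def.2 (Nat.lt_succ_iff.1 j.2)
  have h2 := Submodule.finrank_mono h1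
  rwa [finrank_span_eq_card hc, Fintype.card_fin] at h2

end Forms

/-! ### Counting -/

section Counting

/-- The basis of the double counts, which compare sets of pairs (subspace, vector). -/
lemma ncard_eq_sum_fibers {α β : Type*} [Fintype α] [Finite β] (X : Set (α × β)) :
    X.ncard = ∑ a, {b | (a, b) ∈ X}.ncard := by
  have e : X ≃ Σ a, {b | (a, b) ∈ X} :=
    { toFun := fun p => ⟨p.1.1, p.1.2, p.2⟩
      invFun := fun p => ⟨(p.1, p.2.1), p.2.2⟩
      left_inv := fun _ => rfl
      right_inv := fun _ => rfl }
  rw [← Nat.card_coe_set_eq, Nat.card_congr e, Nat.card_sigma]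
  rfl

lemma mul_le_ncard_of_fibers {α β : Type*} [Finite α] [Finite β] (X : Set (α × β)) (S : Set α)
    (c : ℕ) (h : ∀ a ∈ S, c ≤ {b | (a, b) ∈ X}.ncard) : S.ncard * c ≤ X.ncard := by
  classical
  have := Fintype.ofFinite α
  rw [ncard_eq_sum_fibers, Set.ncard_eq_toFinset_card', ← smul_eq_mul]
  exact (Finset.card_nsmul_le_sum _ _ _ fun a ha => h a (by simpa using ha)).trans
    (Finset.sum_le_sum_of_subset (Finset.subset_univ _))

lemma ncard_le_mul_of_fibers {α β : Type*} [Finite α] [Finite β] (X : Set (α × β)) (S : Set α)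
    (c : ℕ) (hS : ∀ p ∈ X, p.1 ∈ S) (h : ∀ a ∈ S, {b | (a, b) ∈ X}.ncard ≤ c) :
    X.ncard ≤ S.ncard * c := by
  classical
  have := Fintype.ofFinite α
  rw [ncard_eq_sum_fibers, Set.ncard_eq_toFinset_card', ← smul_eq_mul,
    ← Finset.sum_subset (Finset.subset_univ S.toFinset)]
  · exact Finset.sum_le_card_nsmul _ _ _ fun a ha => h a (by simpa using ha)
  · intro a _ ha
    rw [Set.ncard_eq_zero (Set.toFinite _)]
    ext b
    simp only [Set.mem_ofPred_eq, Set.mem_empty_iff_false, iff_false]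
    exact fun hab => ha (by simpa using hS _ hab)

/-! ### Cardinalities of subspaces and their differences over a finite field. -/

variable {F V : Type*} [Field F] [AddCommGroup V] [Module F V] [Module.Finite F V]

lemma ncard_submodule (W : Submodule F V) :
    (W : Set V).ncard = Nat.card F ^ Module.finrank F W := by
  rw [← Nat.card_coe_set_eq]
  exact Module.natCard_eq_pow_finrank (K := F) (V := W)

lemma finrank_inf_ker {T : Submodule F V} {g : V →ₗ[F] F} {t : V} (ht : t ∈ T) (hg : g t ≠ 0) :
    Module.finrank F (T ⊓ LinearMap.ker g : Submodule F V) + 1 = Module.finrank F T := by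
  have hne : g.domRestrict T ≠ 0 := fun h0 => hg (by
    simpa using congrArg (fun f => f (⟨t, ht⟩ : T)) h0)
  rw [← Module.Dual.finrank_ker_add_one_of_ne_zero hne]
  congr 1
  have e : LinearMap.ker (g.domRestrict T) =
      Submodule.comap T.subtype (T ⊓ LinearMap.ker g) := by
    ext x; simp
  rw [e]
  exact (LinearEquiv.finrank_eq (Submodule.comapSubtypeEquivOfLe inf_le_left)).symm

variable [Finite F]

lemma ncard_sdiff_of_finrank {K T : Submodule F V} (hKT : K ≤ T) {a : ℕ}
    (hK : Module.finrank F K = a) (hT : Module.finrank F T = a + 1) :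
    {v | v ∈ T ∧ v ∉ K}.ncard = (Nat.card F - 1) * Nat.card F ^ a := by
  have := Module.finite_of_finite F (M := V)
  have h : {v | v ∈ T ∧ v ∉ K} = (T : Set V) \ (K : Set V) := rfl
  rw [h, Set.ncard_sdiff hKT, ncard_submodule, ncard_submodule, hK, hT, pow_succ,
    Nat.sub_mul, one_mul, mul_comm]

lemma ncard_ne_zero {T : Submodule F V} {g : V →ₗ[F] F} {t : V} (ht : t ∈ T) (hg : g t ≠ 0)
    {a : ℕ} (hT : Module.finrank F T = a + 1) :
    {v | v ∈ T ∧ g v ≠ 0}.ncard = (Nat.card F - 1) * Nat.card F ^ a := by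
  have h1 := finrank_inf_ker ht hg
  rw [← ncard_sdiff_of_finrank (K := T ⊓ LinearMap.ker g) inf_le_left (by omega) hT]
  congr 1
  ext v
  simp only [Set.mem_ofPred_eq, Submodule.mem_inf, LinearMap.mem_ker]
  tauto

lemma ncard_ne_zero_le (T : Submodule F V) (g : V →ₗ[F] F)
    {a : ℕ} (hT : Module.finrank F T = a + 1) :
    {v | v ∈ T ∧ g v ≠ 0}.ncard ≤ (Nat.card F - 1) * Nat.card F ^ a := by
  by_cases h : ∃ t ∈ T, g t ≠ 0
  · obtain ⟨t, ht, hg⟩ := h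
    exact (ncard_ne_zero ht hg hT).le
  · push Not at h
    have : {v | v ∈ T ∧ g v ≠ 0} = ∅ := by
      ext v; simpa using h v
    rw [this, Set.ncard_empty]
    exact Nat.zero_le _

lemma ncard_sdiff_le {L B : Submodule F V} {a : ℕ} (hL : Module.finrank F L = a + 1)
    (hB : a ≤ Module.finrank F (L ⊓ B : Submodule F V)) :
    {v | v ∈ L ∧ v ∉ B}.ncard ≤ (Nat.card F - 1) * Nat.card F ^ a := by
  have heq : {v | v ∈ L ∧ v ∉ B} = {v | v ∈ L ∧ v ∉ L ⊓ B} := by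
    ext v; simp only [Set.mem_ofPred_eq, Submodule.mem_inf]; tauto
  rw [heq]
  have hle := Submodule.finrank_mono (inf_le_left : L ⊓ B ≤ L)
  rcases hB.eq_or_lt with h | h
  · exact (ncard_sdiff_of_finrank inf_le_left h.symm hL).le
  · have : L ⊓ B = L := Submodule.eq_of_le_of_finrank_eq inf_le_left (by omega)
    rw [this]
    simp

/-- A subspace of codimension at least two has at most `|T| / |F|²` elements. -/
lemma ncard_mul_sq_le {K T : Submodule F V} (hKT : K ≤ T) {u v : V} (hu : u ∈ T) (hv : v ∈ T)
    (huv : ∀ x y : F, x • u + y • v ∈ K → x = 0 ∧ y = 0) :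
    (K : Set V).ncard * Nat.card F ^ 2 ≤ (T : Set V).ncard := by
  have hfin := Module.finite_of_finite F (M := V)
  let f : K × F × F → T := fun p =>
    ⟨p.1.1 + (p.2.1 • u + p.2.2 • v), T.add_mem (hKT p.1.2)
      (T.add_mem (T.smul_mem _ hu) (T.smul_mem _ hv))⟩
  have hf : Function.Injective f := by
    rintro ⟨k, x, y⟩ ⟨k', x', y'⟩ h
    have h1 : (k : V) + (x • u + y • v) = k' + (x' • u + y' • v) := congrArg Subtype.val h
    have h2 : (x - x') • u + (y - y') • v = (k' : V) - k := by
      rw [sub_smul, sub_smul]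
      have h3 := sub_eq_zero.2 h1
      rw [← sub_eq_zero, ← h3]
      abel
    obtain ⟨hx, hy⟩ := huv (x - x') (y - y') (h2 ▸ K.sub_mem k'.2 k.2)
    have hx' := sub_eq_zero.1 hx
    have hy' := sub_eq_zero.1 hy
    subst hx' hy'
    have : k = k' := Subtype.ext (add_right_cancel h1)
    rw [this]
  have := Nat.card_le_card_of_injective f hf
  rw [Nat.card_prod, Nat.card_prod, ← sq] at this
  exact this

end Counting

/-! ### Weights of alternating forms on Schubert varieties -/

section Weights

variable {F V : Type*} [Field F] [AddCommGroup V] [Module F V]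

/-- The points of the Schubert variety at which the alternating form `φ` does not vanish. -/
def formSupport {k : ℕ} (A : Fin k → Submodule F V) (φ : V [⋀^Fin k]→ₗ[F] F) :
    Set (Submodule F V) :=
  {L | L ∈ schubertVariety A ∧ NonzeroOn φ L}

variable {k : ℕ}

/-- By the modular law, `L` can be recovered from `L + ⟨v⟩`; this makes the extension map in the
double count injective. -/
lemma sup_span_inf_eq {L B : Submodule F V} (hLB : L ≤ B) {v : V} (hv : v ∉ B) :
    (L ⊔ Submodule.span F {v}) ⊓ B = L := by
  have hv0 : v ≠ 0 := fun h => hv (h ▸ B.zero_mem)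
  have hd : Submodule.span F {v} ⊓ B = ⊥ :=
    ((Submodule.disjoint_span_singleton' hv0).2 hv).symm.eq_bot
  rw [sup_inf_assoc_of_le _ hLB, hd, sup_bot_eq]

/-- The linear form `v ↦ φ(v, w)`. -/
def partialEval (φ : V [⋀^Fin (k + 1)]→ₗ[F] F) (w : Fin k → V) : V →ₗ[F] F where
  toFun v := φ.curryLeft v w
  map_add' x y := by rw [map_add]; rfl
  map_smul' c x := by rw [map_smul]; rfl

lemma partialEval_apply (φ : V [⋀^Fin (k + 1)]→ₗ[F] F) (w : Fin k → V) (v : V) :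
    partialEval φ w v = φ (Matrix.vecCons v w) := rfl

lemma nonzeroOn_sup_span {φ : V [⋀^Fin (k + 1)]→ₗ[F] F} {L : Submodule F V} {v : V}
    (h : NonzeroOn (φ.curryLeft v) L) : NonzeroOn φ (L ⊔ Submodule.span F {v}) := by
  obtain ⟨w, hwL, hw⟩ := h
  refine ⟨Matrix.vecCons v w, fun i => ?_, hw⟩
  refine Fin.cases ?_ (fun i => ?_) i
  · exact Submodule.mem_sup_right (Submodule.mem_span_singleton_self v)
  · exact Submodule.mem_sup_left (hwL i)

/-- The exterior product of a linear form and an alternating form. -/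
def linearWedge (g : V →ₗ[F] F) (ψ : V [⋀^Fin k]→ₗ[F] F) : V [⋀^Fin (k + 1)]→ₗ[F] F :=
  AlternatingMap.alternatizeUncurryFin (g.smulRight ψ)

/-- In the alternating expansion, every term but the first feeds some `w i` to `g`. -/
lemma linearWedge_vecCons (g : V →ₗ[F] F) (ψ : V [⋀^Fin k]→ₗ[F] F) (v : V) {w : Fin k → V}
    (hw : ∀ i, g (w i) = 0) : linearWedge g ψ (Matrix.vecCons v w) = g v * ψ w := by
  rw [linearWedge, AlternatingMap.alternatizeUncurryFin_apply, Fin.sum_univ_succ,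
    Finset.sum_eq_zero]
  · simp [Fin.removeNth_zero, Matrix.vecCons]
  · intro i _
    simp [hw]

variable [Module.Finite F V]

lemma le_last_of_mem {A : Fin (k + 1) → Submodule F V} {L : Submodule F V}
    (hL : L ∈ schubertVariety A) : L ≤ A (Fin.last k) := by
  have h := hL.2 (Fin.last k)
  rw [Fin.val_last] at h
  have h2 := hL.1
  have h3 := Submodule.finrank_mono (inf_le_left : L ⊓ A (Fin.last k) ≤ L)
  exact inf_eq_left.1 (Submodule.eq_of_le_of_finrank_eq inf_le_left (by omega))

lemma finrank_sup_span {L : Submodule F V} {v : V} (hv : v ∉ L) :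
    Module.finrank F (L ⊔ Submodule.span F {v} : Submodule F V) = Module.finrank F L + 1 := by
  have hv0 : v ≠ 0 := fun h => hv (h ▸ L.zero_mem)
  have h := Submodule.finrank_sup_add_finrank_inf_eq L (Submodule.span F {v})
  have hd : L ⊓ Submodule.span F {v} = ⊥ :=
    (Submodule.disjoint_span_singleton' hv0).2 hv |>.eq_bot
  rw [hd, finrank_bot, finrank_span_singleton hv0, add_zero] at h
  exact h

lemma sup_span_mem_schubertVariety {A : Fin (k + 1) → Submodule F V} {L : Submodule F V}
    (hL : L ∈ schubertVariety (fun i => A (Fin.castSucc i))) (hLT : L ≤ A (Fin.last k))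
    {v : V} (hv : v ∈ A (Fin.last k)) (hvL : v ∉ L) :
    L ⊔ Submodule.span F {v} ∈ schubertVariety A := by
  have hfr : Module.finrank F (L ⊔ Submodule.span F {v} : Submodule F V) = k + 1 := by
    rw [finrank_sup_span hvL, hL.1]
  refine ⟨hfr, fun i => ?_⟩
  refine Fin.lastCases ?_ (fun i => ?_) i
  · have : L ⊔ Submodule.span F {v} ≤ A (Fin.last k) :=
      sup_le hLT ((Submodule.span_singleton_le_iff_mem _ _).2 hv)
    rw [inf_eq_left.2 this, hfr, Fin.val_last]
  · exact (hL.2 i).trans (Submodule.finrank_mono (inf_le_inf_right _ le_sup_left))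

/-- The points `L` of the smaller Schubert variety such that `φ` does not vanish on `L + ⟨v⟩` for
some `v` in the last subspace of the flag. -/
def extendableSupport (A : Fin (k + 1) → Submodule F V) (φ : V [⋀^Fin (k + 1)]→ₗ[F] F) :
    Set (Submodule F V) :=
  {L | L ∈ schubertVariety (fun i => A (Fin.castSucc i)) ∧
    ∃ v ∈ A (Fin.last k), NonzeroOn (φ.curryLeft v) L}

lemma exists_basis_of_mem {A : Fin k → Submodule F V} {L : Submodule F V}
    (hL : L ∈ schubertVariety A) :
    ∃ w : Fin k → V, LinearIndependent F w ∧ (∀ i, w i ∈ L) ∧ ∀ i, w i ∈ A i := by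
  obtain ⟨w, hw, hwL⟩ := exists_linearIndependent_mem (fun i => L ⊓ A i) hL.2
  exact ⟨w, hw, fun i => (hwL i).1, fun i => (hwL i).2⟩

/-! ### The three counting inequalities. -/

variable [Finite F]

/-- Pairs `(L, v)` with `v ∈ T \ B` and `φ(v, ·)` nonzero on `L` inject into pairs `(L + ⟨v⟩, v)`. A
fixed `L` has all the `v ∈ T` off a hyperplane, less those in `B`; a fixed `L + ⟨v⟩` meets `B` in
codimension at most one, which bounds its choices of `v`. -/
lemma extendableSupport_mul_le (A : Fin (k + 2) → Submodule F V) (hA : Monotone A)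
    {a a' : ℕ} (hT : Module.finrank F (A (Fin.last (k + 1))) = a + 1)
    (hB : Module.finrank F (A (Fin.last k).castSucc) = a' + 1)
    (φ : V [⋀^Fin (k + 2)]→ₗ[F] F) :
    (extendableSupport A φ).ncard *
        ((Nat.card F - 1) * Nat.card F ^ a - (Nat.card F - 1) * Nat.card F ^ a') ≤
      (formSupport A φ).ncard * ((Nat.card F - 1) * Nat.card F ^ (k + 1)) := by
  have hfin := Module.finite_of_finite F (M := V)
  set B := A (Fin.last k).castSucc with hBdef
  set T := A (Fin.last (k + 1)) with hTdef
  have hBT : B ≤ T := hA (Fin.le_last _)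
  let X : Set (Submodule F V × V) := {p | p.1 ∈ schubertVariety (fun i => A (Fin.castSucc i)) ∧
    (p.2 ∈ T ∧ p.2 ∉ B) ∧ NonzeroOn (φ.curryLeft p.2) p.1}
  let Y : Set (Submodule F V × V) := {p | p.1 ∈ formSupport A φ ∧ (p.2 ∈ p.1 ∧ p.2 ∉ B)}
  have hX : (extendableSupport A φ).ncard *
        ((Nat.card F - 1) * Nat.card F ^ a - (Nat.card F - 1) * Nat.card F ^ a') ≤ X.ncard := by
    refine mul_le_ncard_of_fibers X _ _ ?_
    rintro L ⟨hL, t, ht, hLt⟩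
    obtain ⟨w, hw, hwL, -⟩ := exists_basis_of_mem hL
    have hiff : ∀ v, NonzeroOn (φ.curryLeft v) L ↔ partialEval φ w v ≠ 0 := fun v =>
      nonzeroOn_iff hL.1 hw hwL _
    have hfib : {v | (L, v) ∈ X} =
        {v | v ∈ T ∧ partialEval φ w v ≠ 0} \ {v | v ∈ B ∧ partialEval φ w v ≠ 0} := by
      ext v
      simp only [X, Set.mem_ofPred_eq, Set.mem_sdiff, hiff]
      tauto
    have hsub : {v | v ∈ B ∧ partialEval φ w v ≠ 0} ⊆ {v | v ∈ T ∧ partialEval φ w v ≠ 0} :=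
      fun v hv => ⟨hBT hv.1, hv.2⟩
    rw [hfib, Set.ncard_sdiff hsub,
      ncard_ne_zero ht ((hiff t).1 hLt) hT]
    exact Nat.sub_le_sub_left (ncard_ne_zero_le _ _ hB) _
  have hY : Y.ncard ≤ (formSupport A φ).ncard * ((Nat.card F - 1) * Nat.card F ^ (k + 1)) := by
    refine ncard_le_mul_of_fibers Y _ _ (fun p hp => hp.1) ?_
    intro L hL
    have : {v | (L, v) ∈ Y} = {v | v ∈ L ∧ v ∉ B} := by
      ext v; exact ⟨fun h => h.2, fun h => ⟨hL, h⟩⟩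
    rw [this]
    refine ncard_sdiff_le hL.1.1 ?_
    simpa using hL.1.2 (Fin.last k).castSucc
  refine hX.trans (le_trans ?_ hY)
  refine Set.ncard_le_ncard_of_injOn (fun p => (p.1 ⊔ Submodule.span F {p.2}, p.2)) ?_ ?_
    (Set.toFinite _)
  · rintro ⟨L, v⟩ ⟨hL, ⟨hvT, hvB⟩, hLv⟩
    have hLB : L ≤ B := le_last_of_mem hL
    refine ⟨⟨sup_span_mem_schubertVariety hL (hLB.trans hBT) hvT fun h => hvB (hLB h),
      nonzeroOn_sup_span hLv⟩,
      Submodule.mem_sup_right (Submodule.mem_span_singleton_self v), hvB⟩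
  · rintro ⟨L, v⟩ ⟨hL, ⟨-, hvB⟩, -⟩ ⟨L', v'⟩ ⟨hL', -, -⟩ h
    obtain ⟨h1, hv⟩ := Prod.ext_iff.1 h
    obtain rfl : v = v' := hv
    have h2 := congrArg (· ⊓ B) h1
    have h3 : L = L' :=
      (sup_span_inf_eq (le_last_of_mem hL) hvB).symm.trans
        (h2.trans (sup_span_inf_eq (le_last_of_mem hL') hvB))
    rw [h3]

/-- The subspace of those `v` in the last subspace of the flag such that `φ(v, ·)` vanishes on
the smaller Schubert variety. -/
def degenerateSubspace (A : Fin (k + 1) → Submodule F V) (φ : V [⋀^Fin (k + 1)]→ₗ[F] F) :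
    Submodule F V where
  carrier := {v | v ∈ A (Fin.last k) ∧ ∀ L ∈ schubertVariety (fun i => A (Fin.castSucc i)),
    ∀ w : Fin k → V, (∀ i, w i ∈ L) → partialEval φ w v = 0}
  add_mem' := fun hx hy => ⟨add_mem hx.1 hy.1, fun L hL w hw => by
    rw [map_add, hx.2 L hL w hw, hy.2 L hL w hw, add_zero]⟩
  zero_mem' := ⟨zero_mem _, fun L hL w hw => map_zero _⟩
  smul_mem' := fun c x hx => ⟨Submodule.smul_mem _ c hx.1, fun L hL w hw => by
    rw [map_smul, hx.2 L hL w hw, smul_zero]⟩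

/-- The degenerate subspace has codimension at least two in the last subspace: `u` and the last
vector `x` of an adapted basis of `L` are independent modulo it. Since `u` lies in the last but one
subspace, exchanging `u` and `x` yields another point of the smaller variety. -/
lemma degenerateSubspace_ncard_le {A : Fin (k + 2) → Submodule F V} (hA : Monotone A)
    {φ : V [⋀^Fin (k + 2)]→ₗ[F] F} {L : Submodule F V}
    (hL : L ∈ schubertVariety (fun i => A (Fin.castSucc i)))
    {u : V} (hu : u ∈ A (Fin.last k).castSucc) (hLu : NonzeroOn (φ.curryLeft u) L) :
    (degenerateSubspace A φ : Set V).ncard * Nat.card F ^ 2 ≤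
      (A (Fin.last (k + 1)) : Set V).ncard := by
  have hBT : A (Fin.last k).castSucc ≤ A (Fin.last (k + 1)) := hA (Fin.le_last _)
  obtain ⟨w, hw, hwL, hwA⟩ := exists_basis_of_mem hL
  have hne : φ (Matrix.vecCons u w) ≠ 0 := (nonzeroOn_iff hL.1 hw hwL _).1 hLu
  set x := w (Fin.last k) with hx
  have hxL : x ∈ L := hwL _
  let w' := Function.update w (Fin.last k) u
  have hswap : φ (Matrix.vecCons x w') ≠ 0 := by
    have : Matrix.vecCons x w' = Matrix.vecCons u w ∘ Equiv.swap 0 (Fin.last k).succ := by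
      funext i
      refine Fin.cases ?_ (fun i => ?_) i
      · rw [Function.comp_apply, Equiv.swap_apply_left]
        rfl
      · by_cases hi : i = Fin.last k
        · subst hi
          rw [Function.comp_apply, Equiv.swap_apply_right]
          exact Function.update_self _ _ _
        · have : Equiv.swap 0 (Fin.last k).succ i.succ = i.succ :=
            Equiv.swap_apply_of_ne_of_ne (Fin.succ_ne_zero i) (by simpa using hi)
          rw [Function.comp_apply, this]
          simp [w', hi]
    rw [this, φ.map_swap _ (Fin.succ_ne_zero _).symm]
    exact neg_ne_zero.2 hne
  have hw' : LinearIndependent F w' :=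
    linearIndependent_of_map_ne_zero (φ := φ.curryLeft x) hswap
  have hw'A : ∀ i, w' i ∈ A i.castSucc := by
    intro i
    by_cases hi : i = Fin.last k
    · subst hi; simpa [w'] using hu
    · simpa [w', hi] using hwA i
  have hL' := span_mem_schubertVariety (A := fun i => A (Fin.castSucc i))
    (fun i j hij => hA (Fin.castSucc_le_castSucc_iff.2 hij)) hw' hw'A
  refine ncard_mul_sq_le (u := u) (v := x) (fun v hv => hv.1) (hBT hu)
    (hBT (le_last_of_mem hL hxL)) ?_
  intro c d hcd
  -- Evaluation at `w` kills `x`, which occurs in `w`, and so isolates `c`; evaluation at `w'` then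
  -- isolates `d`.
  have hc : c = 0 := by
    have h := hcd.2 L hL w hwL
    have hxw : partialEval φ w x = 0 := by
      rw [partialEval_apply]
      refine φ.map_eq_zero_of_eq _ (i := 0) (j := (Fin.last k).succ) rfl (Fin.succ_ne_zero _).symm
    rw [map_add, map_smul, map_smul, hxw, smul_zero, add_zero, smul_eq_mul] at h
    exact (mul_eq_zero.1 h).resolve_right hne
  refine ⟨hc, ?_⟩
  have h := hcd.2 _ hL' w' fun i => Submodule.subset_span ⟨i, rfl⟩
  rw [hc, zero_smul, zero_add, map_smul, smul_eq_mul] at h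
  exact (mul_eq_zero.1 h).resolve_right hswap

/-- A union bound: the supports of the forms `φ(v, ·)` cover many points, in the manner of the
second generalized Hamming weight. -/
lemma mul_le_extendableSupport {A : Fin (k + 2) → Submodule F V} (hA : Monotone A)
    {φ : V [⋀^Fin (k + 2)]→ₗ[F] F} {d a : ℕ}
    (hd : ∀ ψ : V [⋀^Fin (k + 1)]→ₗ[F] F,
      (formSupport (fun i => A (Fin.castSucc i)) ψ).Nonempty →
        d ≤ (formSupport (fun i => A (Fin.castSucc i)) ψ).ncard)
    (hT : Module.finrank F (A (Fin.last (k + 1))) = a + 2) {L : Submodule F V}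
    (hL : L ∈ schubertVariety (fun i => A (Fin.castSucc i)))
    {u : V} (hu : u ∈ A (Fin.last k).castSucc) (hLu : NonzeroOn (φ.curryLeft u) L) :
    (Nat.card F ^ (a + 2) - Nat.card F ^ a) * d ≤
      (extendableSupport A φ).ncard * ((Nat.card F - 1) * Nat.card F ^ (a + 1)) := by
  have hfin := Module.finite_of_finite F (M := V)
  set T := A (Fin.last (k + 1)) with hTdef
  let Z : Set (Submodule F V × V) := {p | p.1 ∈ schubertVariety (fun i => A (Fin.castSucc i)) ∧
    p.2 ∈ T ∧ NonzeroOn (φ.curryLeft p.2) p.1}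
  have hZ : Z.ncard ≤
      (extendableSupport A φ).ncard * ((Nat.card F - 1) * Nat.card F ^ (a + 1)) := by
    refine ncard_le_mul_of_fibers Z _ _ (fun p hp => ⟨hp.1, p.2, hp.2⟩) ?_
    rintro L ⟨hL, t, ht, hLt⟩
    obtain ⟨w, hw, hwL, -⟩ := exists_basis_of_mem hL
    have hfib : {v | (L, v) ∈ Z} = {v | v ∈ T ∧ partialEval φ w v ≠ 0} := by
      ext v
      have := nonzeroOn_iff hL.1 hw hwL (φ.curryLeft v)
      exact ⟨fun h => ⟨h.2.1, this.1 h.2.2⟩, fun h => ⟨hL, h.1, this.2 h.2⟩⟩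
    rw [hfib]
    exact ncard_ne_zero_le _ _ hT
  refine le_trans ?_ hZ
  let Z' : Set (V × Submodule F V) := Prod.swap '' Z
  have hZ' : Z'.ncard = Z.ncard := Set.ncard_image_of_injective _ Prod.swap_injective
  rw [← hZ']
  have hK : Nat.card F ^ (a + 2) - Nat.card F ^ a ≤
      {v | v ∈ T ∧ v ∉ degenerateSubspace A φ}.ncard := by
    have h : {v | v ∈ T ∧ v ∉ degenerateSubspace A φ} =
      (T : Set V) \ (degenerateSubspace A φ : Set V) := rfl
    have hcard := degenerateSubspace_ncard_le hA hL hu hLu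
    rw [h, Set.ncard_sdiff fun v hv => hv.1]
    rw [ncard_submodule T, hT] at hcard ⊢
    refine Nat.sub_le_sub_left ?_ _
    rw [pow_add] at hcard
    exact Nat.le_of_mul_le_mul_right hcard (pow_pos Nat.card_pos 2)
  refine (Nat.mul_le_mul_right d hK).trans (mul_le_ncard_of_fibers Z' _ _ ?_)
  -- Outside the degenerate subspace, `φ(v, ·)` has nonzero weight on the smaller variety, hence
  -- weight at least `d`.
  rintro v ⟨hvT, hvK⟩
  have hfib : {M | (v, M) ∈ Z'} =
      formSupport (fun i => A (Fin.castSucc i)) (φ.curryLeft v) := by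
    ext M
    constructor
    · rintro ⟨⟨M', v'⟩, hM, h⟩
      obtain ⟨rfl, rfl⟩ := Prod.ext_iff.1 h
      exact ⟨hM.1, hM.2.2⟩
    · rintro ⟨hM, hn⟩
      exact ⟨(M, v), ⟨hM, hvT, hn⟩, rfl⟩
  rw [hfib]
  refine hd _ ?_
  by_contra hempty
  rw [Set.not_nonempty_iff_eq_empty] at hempty
  refine hvK ⟨hvT, fun M hM w hw => ?_⟩
  by_contra hne
  have : M ∈ formSupport (fun i => A (Fin.castSucc i)) (φ.curryLeft v) := ⟨hM, w, hw, hne⟩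
  rw [hempty] at this
  exact this

/-- As `g` kills `B`, a point `L` of the support meets `B` in a hyperplane `L ⊓ B` of `L`, at which
`ψ` is nonzero. The count runs over pairs `(L, v)` with `v ∈ L \ B`, sent to `(L ⊓ B, v)`; `L` is
recovered as `L ⊓ B + ⟨v⟩`. -/
lemma formSupport_linearWedge_mul_le {A : Fin (k + 2) → Submodule F V}
    {a : ℕ} (hT : Module.finrank F (A (Fin.last (k + 1))) = a + 1) (hA : Monotone A)
    (ψ : V [⋀^Fin (k + 1)]→ₗ[F] F) {g : V →ₗ[F] F}
    (hg : A (Fin.last k).castSucc ≤ LinearMap.ker g) :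
    (formSupport A (linearWedge g ψ)).ncard * ((Nat.card F - 1) * Nat.card F ^ (k + 1)) ≤
      (formSupport (fun i => A (Fin.castSucc i)) ψ).ncard *
        ((Nat.card F - 1) * Nat.card F ^ a) := by
  have hfin := Module.finite_of_finite F (M := V)
  set B := A (Fin.last k).castSucc with hBdef
  set T := A (Fin.last (k + 1)) with hTdef
  have hinf : ∀ L ∈ formSupport A (linearWedge g ψ),
      Module.finrank F (L ⊓ B : Submodule F V) = k + 1 := by
    rintro L ⟨hL, w, hwL, hw⟩
    have h1 : k + 1 ≤ Module.finrank F (L ⊓ B : Submodule F V) := by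
      simpa using hL.2 (Fin.last k).castSucc
    have h2 := Submodule.finrank_mono (inf_le_left : L ⊓ B ≤ L)
    have h3 := hL.1
    by_contra hne
    have h4 : L ⊓ B = L := Submodule.eq_of_le_of_finrank_eq inf_le_left (by omega)
    apply hw
    have hLB : L ≤ B := inf_eq_left.1 h4
    rw [← Matrix.cons_head_tail w, linearWedge_vecCons, hg (hLB (hwL 0)) |> fun h =>
      (show g (Matrix.vecHead w) = 0 from h), zero_mul]
    exact fun i => hg (hLB (hwL i.succ))
  let Y : Set (Submodule F V × V) :=
    {p | p.1 ∈ formSupport A (linearWedge g ψ) ∧ (p.2 ∈ p.1 ∧ p.2 ∉ B)}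
  let X : Set (Submodule F V × V) :=
    {p | p.1 ∈ formSupport (fun i => A (Fin.castSucc i)) ψ ∧ (p.2 ∈ T ∧ g p.2 ≠ 0)}
  have hY : (formSupport A (linearWedge g ψ)).ncard *
      ((Nat.card F - 1) * Nat.card F ^ (k + 1)) ≤ Y.ncard := by
    refine mul_le_ncard_of_fibers Y _ _ fun L hL => ?_
    have : {v | (L, v) ∈ Y} = {v | v ∈ L ∧ v ∉ L ⊓ B} := by
      ext v
      simp only [Y, Set.mem_ofPred_eq, Submodule.mem_inf]
      tauto
    rw [this, ncard_sdiff_of_finrank inf_le_left (hinf L hL) hL.1.1]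
  have hX : X.ncard ≤ (formSupport (fun i => A (Fin.castSucc i)) ψ).ncard *
        ((Nat.card F - 1) * Nat.card F ^ a) := by
    refine ncard_le_mul_of_fibers X _ _ (fun p hp => hp.1) fun L hL => ?_
    have : {v | (L, v) ∈ X} = {v | v ∈ T ∧ g v ≠ 0} := by
      ext v; exact ⟨fun h => h.2, fun h => ⟨hL, h⟩⟩
    rw [this]
    exact ncard_ne_zero_le _ _ hT
  refine hY.trans (le_trans ?_ hX)
  have hsup : ∀ p ∈ Y, p.1 ⊓ B ⊔ Submodule.span F {p.2} = p.1 := by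
    rintro ⟨L, v⟩ ⟨hL, hvL, hvB⟩
    refine Submodule.eq_of_le_of_finrank_eq
      (sup_le inf_le_left ((Submodule.span_singleton_le_iff_mem _ _).2 hvL)) ?_
    rw [finrank_sup_span (L := L ⊓ B) (v := v) fun h => hvB h.2, hinf L hL, hL.1.1]
  refine Set.ncard_le_ncard_of_injOn (fun p => (p.1 ⊓ B, p.2)) ?_ ?_ (Set.toFinite _)
  · rintro ⟨L, v⟩ ⟨hL, hvL, hvB⟩
    have hmem : L ⊓ B ∈ schubertVariety (fun i => A (Fin.castSucc i)) := by
      refine ⟨hinf L hL, fun i => ?_⟩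
      have hle : A i.castSucc ≤ B := hA (Fin.castSucc_le_castSucc_iff.2 (Fin.le_last i))
      rw [inf_assoc, inf_eq_right.2 hle]
      exact hL.1.2 i.castSucc
    obtain ⟨w, hw, hwL, -⟩ := exists_basis_of_mem hmem
    have hspan := span_eq_of_finrank_eq hmem.1 hw hwL
    have hli : LinearIndependent F (Matrix.vecCons v w) :=
      linearIndependent_finCons.2 ⟨hw, by rw [hspan]; exact fun h => hvB (Submodule.mem_inf.1 h).2⟩
    have hne : linearWedge g ψ (Matrix.vecCons v w) ≠ 0 := by
      refine (nonzeroOn_iff hL.1.1 hli (fun i => ?_) _).1 hL.2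
      refine Fin.cases ?_ (fun i => ?_) i
      · exact hvL
      · exact (hwL i).1
    rw [linearWedge_vecCons _ _ _ fun i => hg (hwL i).2] at hne
    exact ⟨⟨hmem, w, hwL, right_ne_zero_of_mul hne⟩, le_last_of_mem hL.1 hvL,
      left_ne_zero_of_mul hne⟩
  · rintro ⟨L, v⟩ hp ⟨L', v'⟩ hp' h
    obtain ⟨h1, rfl⟩ := Prod.ext_iff.1 h
    rw [Prod.mk.injEq]
    refine ⟨?_, rfl⟩
    have e1 := hsup _ hp
    have e2 := hsup _ hp'
    simp only [] at e1 e2 h1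
    rw [← e1, ← e2, h1]

end Weights

/-! ### Comparison of weights -/

section Comparison

/-- Here `dim B = c + 1` and `dim T = c + e + 3`. After cancellation, chaining the three bounds
leaves a margin of `d q^c (q^(e+2) - q - 1)`. -/
lemma weight_lt_of_bounds {q c e k N N₀ E d : ℕ} (hq : 1 < q) (hd : 0 < d)
    (h₁ : E * ((q - 1) * q ^ (c + e + 2) - (q - 1) * q ^ c) ≤ N * ((q - 1) * q ^ (k + 1)))
    (h₂ : (q ^ (c + e + 1 + 2) - q ^ (c + e + 1)) * d ≤ E * ((q - 1) * q ^ (c + e + 1 + 1)))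
    (h₃ : N₀ * ((q - 1) * q ^ (k + 1)) ≤ d * ((q - 1) * q ^ (c + e + 2))) : N₀ < N := by
  have hq0 : 0 < q := by omega
  have hle₁ : (q - 1) * q ^ c ≤ (q - 1) * q ^ (c + e + 2) :=
    Nat.mul_le_mul_left _ (Nat.pow_le_pow_right hq0 (by omega))
  have hle₂ : q ^ (c + e + 1) ≤ q ^ (c + e + 1 + 2) := Nat.pow_le_pow_right hq0 (by omega)
  zify [hle₁, hle₂, hq.le] at h₁ h₂ h₃ hd hq ⊢
  have hx : (0 : ℤ) < (q : ℤ) ^ c := by positivity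
  have hy : (1 : ℤ) ≤ (q : ℤ) ^ e := one_le_pow₀ hq.le
  have hp : (0 : ℤ) < (q : ℤ) ^ (k + 1) := by positivity
  simp only [pow_add, pow_one] at h₁ h₂ h₃
  rw [pow_succ] at hp
  generalize (q : ℤ) ^ c = x at *
  generalize (q : ℤ) ^ e = y at *
  generalize (q : ℤ) ^ k * (q : ℤ) = p at *
  generalize (q : ℤ) = q at *
  have hr : (0 : ℤ) < q - 1 := by linarith
  have g₁ : (E : ℤ) * (x * (y * q ^ 2 - 1)) ≤ N * p := by
    refine le_of_mul_le_mul_left ?_ hr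
    linear_combination h₁
  have g₂ : (q + 1) * d ≤ E * q := by
    refine le_of_mul_le_mul_left ?_ (by positivity : 0 < (q - 1) * (x * y * q))
    linear_combination h₂
  have g₃ : N₀ * p ≤ d * (x * y * q ^ 2) := by
    refine le_of_mul_le_mul_left ?_ hr
    linear_combination h₃
  -- The gap of two is needed here: a gap of one would leave `q - q - 1 < 0`.
  have hyq : 0 < y * q ^ 2 - q - 1 := by nlinarith
  have g₄ : q * (N₀ * p) < q * (N * p) := by
    have a₁ := mul_le_mul_of_nonneg_left g₁ (by linarith : 0 ≤ q)
    have a₂ := mul_le_mul_of_nonneg_right g₂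
      (mul_nonneg hx.le (by linarith) : 0 ≤ x * (y * q ^ 2 - 1))
    have a₃ := mul_le_mul_of_nonneg_left g₃ (by linarith : 0 ≤ q)
    have a₄ : 0 < d * x * (y * q ^ 2 - q - 1) := by positivity
    linarith
  exact lt_of_mul_lt_mul_right (lt_of_mul_lt_mul_left g₄ (by linarith)) hp.le

variable {F V : Type*} [Field F] [Finite F] [AddCommGroup V] [Module F V] [Module.Finite F V]

/-- If `α_ℓ ≥ α_{ℓ-1} + 2`, a form that does not vanish on some point of the Schubert variety
contained in `A_{ℓ-1}` does not have the least possible nonzero weight. -/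
lemma exists_smaller_formSupport {k : ℕ} {A : Fin (k + 2) → Submodule F V} (hA : Monotone A)
    (hgap : Module.finrank F (A (Fin.last k).castSucc) + 2 ≤
      Module.finrank F (A (Fin.last (k + 1))))
    {φ : V [⋀^Fin (k + 2)]→ₗ[F] F} {L : Submodule F V} (hL : L ∈ formSupport A φ)
    (hLB : L ≤ A (Fin.last k).castSucc) :
    ∃ φ' : V [⋀^Fin (k + 2)]→ₗ[F] F, (formSupport A φ').Nonempty ∧
      (formSupport A φ').ncard < (formSupport A φ).ncard := by
  have hfin := Module.finite_of_finite F (M := V)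
  set B := A (Fin.last k).castSucc with hBdef
  set T := A (Fin.last (k + 1)) with hTdef
  set A' : Fin (k + 1) → Submodule F V := fun i => A (Fin.castSucc i) with hA'
  have hBT : B ≤ T := hA (Fin.le_last _)
  obtain ⟨hLΩ, hLφ⟩ := hL
  obtain ⟨w, hw, hwL, hwA⟩ := exists_basis_of_mem hLΩ
  have hwφ := (nonzeroOn_iff hLΩ.1 hw hwL φ).1 hLφ
  -- split off the last vector of an adapted basis of `L`
  set u := w (Fin.last (k + 1)) with hu
  have hw₁ : LinearIndependent F (Fin.init w) := hw.comp _ (Fin.castSucc_injective _)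
  have hL₁ : Submodule.span F (Set.range (Fin.init w)) ∈ schubertVariety A' :=
    span_mem_schubertVariety (fun i j hij => hA (Fin.castSucc_le_castSucc_iff.2 hij)) hw₁
      fun i => hwA i.castSucc
  have huB : u ∈ B := hLB (hwL _)
  have hcons : φ (Matrix.vecCons u (Fin.init w)) ≠ 0 := by
    have hli : LinearIndependent F (Matrix.vecCons u (Fin.init w)) := by
      have h := hw
      rw [← Fin.snoc_init_self w, linearIndependent_finSnoc] at h
      exact linearIndependent_finCons.2 h
    refine (nonzeroOn_iff hLΩ.1 hli (fun i => ?_) φ).1 hLφ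
    refine Fin.cases ?_ (fun i => ?_) i
    · exact hwL _
    · exact hwL i.castSucc
  have hLu : NonzeroOn (φ.curryLeft u) (Submodule.span F (Set.range (Fin.init w))) :=
    ⟨Fin.init w, fun i => Submodule.subset_span ⟨i, rfl⟩, hcons⟩
  -- a form of least nonzero weight on the smaller Schubert variety
  obtain ⟨ψ, hψ, hmin⟩ : ∃ ψ : V [⋀^Fin (k + 1)]→ₗ[F] F, (formSupport A' ψ).Nonempty ∧
      ∀ ψ' : V [⋀^Fin (k + 1)]→ₗ[F] F, (formSupport A' ψ').Nonempty →
        (formSupport A' ψ).ncard ≤ (formSupport A' ψ').ncard := by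
    let S : Set (V [⋀^Fin (k + 1)]→ₗ[F] F) := {ψ | (formSupport A' ψ).Nonempty}
    have hS : S.Nonempty := ⟨φ.curryLeft u, _, hL₁, hLu⟩
    let wt : V [⋀^Fin (k + 1)]→ₗ[F] F → ℕ := fun ψ => (formSupport A' ψ).ncard
    exact ⟨Function.argminOn wt S hS, Function.argminOn_mem _ S hS,
      fun ψ' h => Function.argminOn_le wt S h⟩
  have hdpos : 0 < (formSupport A' ψ).ncard := (Set.ncard_pos (Set.toFinite _)).2 hψ
  have hBpos : 0 < Module.finrank F B := by
    have h := Submodule.finrank_mono hLB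
    rw [hLΩ.1] at h
    omega
  obtain ⟨c, hc⟩ := Nat.exists_eq_add_of_le' hBpos
  obtain ⟨e, he⟩ := Nat.exists_eq_add_of_le hgap
  have hTfr : Module.finrank F T = (c + e + 2) + 1 := by omega
  -- a linear form vanishing on `B` but not on `T`
  obtain ⟨t, htT, htB⟩ : ∃ t ∈ T, t ∉ B := by
    apply SetLike.not_le_iff_exists.1
    intro hle
    have := Submodule.finrank_mono hle
    omega
  obtain ⟨g, hgt, hgB⟩ := Submodule.exists_le_ker_of_notMem htB
  refine ⟨linearWedge g ψ, ?_, ?_⟩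
  · obtain ⟨M, hM, v, hvM, hv⟩ := hψ
    have hMB : M ≤ B := le_last_of_mem hM
    refine ⟨M ⊔ Submodule.span F {t}, sup_span_mem_schubertVariety hM (hMB.trans hBT) htT
      fun h => htB (hMB h), nonzeroOn_sup_span ⟨v, hvM, ?_⟩⟩
    rw [AlternatingMap.curryLeft_apply_apply, linearWedge_vecCons _ _ _ fun i => hgB (hMB (hvM i))]
    exact mul_ne_zero hgt hv
  · have h₁ := extendableSupport_mul_le A hA hTfr hc φ
    have h₂ := mul_le_extendableSupport hA hmin (a := c + e + 1) hTfr hL₁ huB hLu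
    have h₃ := formSupport_linearWedge_mul_le hTfr hA ψ hgB
    change _ ≤ (formSupport A' ψ).ncard * _ at h₃
    generalize (formSupport A φ).ncard = N at *
    generalize (formSupport A (linearWedge g ψ)).ncard = N₀ at *
    generalize (formSupport A' ψ).ncard = d at *
    generalize (extendableSupport A φ).ncard = E at *
    exact weight_lt_of_bounds Finite.one_lt_card hdpos h₁ h₂ h₃

end Comparison

/-! ### Codewords and alternating forms -/

section Codewords

variable {F V : Type*} [Field F] [AddCommGroup V] [Module F V] [Module.Finite F V]

/-- The factors of `P j` are independent because `P j ≠ 0`, and they lie in its annihilator `L`;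
they therefore form a basis of `L`, on which the form can be tested. -/
lemma evalMap_ne_zero_iff {ℓ m n : ℕ} (h : ℓ ≤ m) (b : Module.Basis (Fin m) F V)
    {A : Fin ℓ → Submodule F V} {P : Fin n → ⋀[F]^ℓ V} {L : Submodule F V}
    (hL : L ∈ schubertVariety A) {j : Fin n} (hP : IsRepresentative A L (P j))
    (f : ⋀[F]^(m - ℓ) V) :
    evalMap h b P f j ≠ 0 ↔ NonzeroOn (wedgeForm (Nat.sub_add_cancel h) b f) L := by
  obtain ⟨hP0, ⟨v, -, hPv⟩, hann⟩ := hP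
  have hli : LinearIndependent F (fun i => v (Fin.rev i)) := by
    by_contra hv
    exact hP0 (hPv.trans ((exteriorPower.ιMulti F ℓ).map_linearDependent _ hv))
  have hmem : ∀ i : Fin ℓ, v (Fin.rev i) ∈ L := fun i => by
    rw [← hann, hPv]
    exact mem_annihilator_ιMulti (fun i => v (Fin.rev i)) i
  rw [nonzeroOn_iff hL.1 hli hmem, wedgeForm_apply, ← hPv]
  rfl

lemma hammingNorm_evalMap [DecidableEq F] {ℓ m n : ℕ} (h : ℓ ≤ m)
    (b : Module.Basis (Fin m) F V) {A : Fin ℓ → Submodule F V} (L : Fin n ≃ schubertVariety A)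
    {P : Fin n → ⋀[F]^ℓ V} (hP : ∀ j, IsRepresentative A (L j) (P j)) (f : ⋀[F]^(m - ℓ) V) :
    hammingNorm (evalMap h b P f) =
      (formSupport A (wedgeForm (Nat.sub_add_cancel h) b f)).ncard := by
  have himg : formSupport A (wedgeForm (Nat.sub_add_cancel h) b f) =
      (fun j => (L j : Submodule F V)) '' {j | evalMap h b P f j ≠ 0} := by
    ext M
    constructor
    · rintro ⟨hM, hn⟩
      refine ⟨L.symm ⟨M, hM⟩, ?_, by simp⟩
      exact (evalMap_ne_zero_iff h b (L _).2 (hP _) f).2 (by simpa using hn)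
    · rintro ⟨j, hj, rfl⟩
      exact ⟨(L j).2, (evalMap_ne_zero_iff h b (L j).2 (hP j) f).1 hj⟩
  rw [himg, Set.ncard_image_of_injective _ fun i j hij => L.injective (Subtype.ext hij),
    hammingNorm, Set.ncard_eq_toFinset_card']
  congr 1
  ext j
  simp

lemma two_mul_add_one_le_finrank {ℓ : ℕ} {A : Fin ℓ → Submodule F V} (hA0 : ∀ i, A i ≠ ⊥)
    (hcnc : CompletelyNonConsecutive (dimSeq A)) :
    ∀ i : ℕ, ∀ hi : i < ℓ, 2 * i + 1 ≤ Module.finrank F (A ⟨i, hi⟩)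
  | 0, hi => by
    have := Submodule.one_le_finrank_iff.2 (hA0 ⟨0, hi⟩)
    omega
  | i + 1, hi => by
    have h := two_mul_add_one_le_finrank hA0 hcnc i (by omega)
    have h' : Module.finrank F (A ⟨i, _⟩) + 2 ≤ Module.finrank F (A ⟨i + 1, hi⟩) :=
      hcnc ⟨i, by omega⟩ ⟨i + 1, hi⟩ rfl
    omega

end Codewords

end SchubertCodes

theorem corollary7p7 {F V : Type*} [Field F] [Finite F] [DecidableEq F]
    [AddCommGroup V] [Module F V] (ℓ m n : ℕ) (hlm : ℓ < m)
    (b : Module.Basis (Fin m) F V)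
    (A : Fin ℓ → Submodule F V) (hA : StrictMono A) (hA0 : ∀ i, A i ≠ ⊥)
    (L : Fin n ≃ SchubertCodes.schubertVariety A)
    (P : Fin n → ⋀[F]^ℓ V) (hP : ∀ j, SchubertCodes.IsRepresentative A (L j) (P j))
    (hcnc : SchubertCodes.CompletelyNonConsecutive (SchubertCodes.dimSeq A)) (hl : 2 < ℓ) :
    ¬ SchubertCodes.IsGeneratedByMinWeight (SchubertCodes.schubertCode hlm.le b P) := by
  open SchubertCodes in
  intro hgen
  have hfin : Module.Finite F V := Module.Finite.of_basis b
  obtain ⟨k, rfl⟩ := Nat.exists_eq_add_of_le' hl.le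
  have hmono := hA.monotone
  -- With `ℓ = k + 2`, the hypothesis `ℓ > 2` gives `k ≥ 1`, hence `2k + 1 ≥ k + 2`.
  have hBdim : k + 2 ≤ Module.finrank F (A (Fin.last k).castSucc) := by
    have h : 2 * k + 1 ≤ Module.finrank F (A (Fin.last k).castSucc) :=
      two_mul_add_one_le_finrank hA0 hcnc k (by omega)
    omega
  have hgap : Module.finrank F (A (Fin.last k).castSucc) + 2 ≤
      Module.finrank F (A (Fin.last (k + 1))) :=
    hcnc (Fin.last k).castSucc (Fin.last (k + 1)) (by simp)
  -- a point of the Schubert variety inside the last but one subspace of the flag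
  obtain ⟨w, hw, hwA⟩ := exists_linearIndependent_mem
    (fun i => A (Fin.last k).castSucc ⊓ A i) fun i => by
      refine Fin.lastCases ?_ (fun i => ?_) i
      · rw [inf_eq_left.2 (hmono (Fin.le_last _)), Fin.val_last]
        exact hBdim
      · rw [inf_eq_right.2 (hmono (Fin.castSucc_le_castSucc_iff.2 (Fin.le_last i)))]
        have h : 2 * (i : ℕ) + 1 ≤ Module.finrank F (A i.castSucc) :=
          two_mul_add_one_le_finrank hA0 hcnc i (by omega)
        rw [Fin.val_castSucc]
        omega
  have hM := span_mem_schubertVariety hmono hw fun i => (hwA i).2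
  set M := Submodule.span F (Set.range w) with hMdef
  have hMB : M ≤ A (Fin.last k).castSucc := by
    refine Submodule.span_le.2 ?_
    rintro _ ⟨i, rfl⟩
    exact (hwA i).1
  set j := L.symm ⟨M, hM⟩ with hj
  have hLj : (L j : Submodule F V) = M := by simp [hj]
  -- minimum weight codewords vanish at this point
  have hvanish : ∀ c ∈ minWeightCodewords (schubertCode hlm.le b P), c j = 0 := by
    rintro c ⟨⟨f, rfl⟩, hc⟩
    by_contra hne
    have hn := (evalMap_ne_zero_iff hlm.le b (L j).2 (hP j) f).1 hne
    rw [hLj] at hn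
    obtain ⟨φ', hφ', hlt⟩ := exists_smaller_formSupport hmono hgap ⟨hM, hn⟩ hMB
    obtain ⟨f', rfl⟩ := wedgeForm_surjective (Nat.sub_add_cancel hlm.le) b φ'
    rw [← hammingNorm_evalMap hlm.le b L hP, ← hammingNorm_evalMap hlm.le b L hP, hc] at hlt
    refine hlt.not_ge (Nat.sInf_le ⟨_, ⟨f', rfl⟩, ?_, rfl⟩)
    obtain ⟨M', hM', hn'⟩ := hφ'
    intro h0
    refine (evalMap_ne_zero_iff hlm.le b (L (L.symm ⟨M', hM'⟩)).2 (hP _) f').2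
      (by simpa using hn') ?_
    rw [h0]
    rfl
  -- but some codeword does not
  obtain ⟨φ, hφ⟩ := exists_map_ne_zero hw
  obtain ⟨f, rfl⟩ := wedgeForm_surjective (Nat.sub_add_cancel hlm.le) b φ
  have hf : evalMap hlm.le b P f j ≠ 0 := by
    refine (evalMap_ne_zero_iff hlm.le b (L j).2 (hP j) f).2 ?_
    rw [hLj]
    exact ⟨w, fun i => Submodule.subset_span ⟨i, rfl⟩, hφ⟩
  -- Vanishing at `j` is a linear condition, so it passes to the span.
  have hle : Submodule.span F (minWeightCodewords (schubertCode hlm.le b P)) ≤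
      LinearMap.ker (LinearMap.proj (R := F) (φ := fun _ : Fin n => F) j) :=
    Submodule.span_le.2 hvanish
  have hmem : evalMap hlm.le b P f ∈
      Submodule.span F (minWeightCodewords (schubertCode hlm.le b P)) := by
    rw [hgen]
    exact ⟨f, rfl⟩
  exact hf (hle hmem)
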